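/- A straight-line drawing of a finite graph $G$ represents the vertices by distinct points in the plane and every edge by the straight-line segment between its endpoints, such that no three vertices are collinear and no point lies in the interior of three distinct edges. Two distinct edges cross if their interiors have a point in common, and the rectilinear crossing number $\overline{\mathrm{cr}}(G)$ is the minimum number of pairs of crossing edges in any straight-line drawing of $G$. For vertex sets $X, Y$ of $G$ let $e_G(X,Y)$ be the number of ordered pairs $(x,y)\in X\times Y$ such that $xy$ is an edge of $G$. Theorem. Fix $0<p<1$ and let $(G_n : n=1,2,\ldots)$ be a sequence of graphs with $|V(G_n)|=n$ that is quasi-random with density $p$, i.e. $e_{G_n}(X,Y)=p|X||Y|+o(n^2)$ for all $X,Y\subseteq V(G_n)$, where the $o(n^2)$ term is uniform in $X$ and $Y$. Then $$\overline{\mathrm{cr}}(G_n)=(1+o(1))\,p^2\,\overline{\mathrm{cr}}(K_n)\qquad (n\to\infty).$$ -/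

import Mathlib

/-- The Euclidean plane. -/
abbrev Plane : Type := EuclideanSpace ℝ (Fin 2)

/-- The interior of the straight-line segment that represents the edge `uv` when the vertices
are placed by `f`: the open segment from `f u` to `f v`. -/
def edgeInterior {V : Type*} (f : V → Plane) : Sym2 V → Set Plane :=
  Sym2.lift ⟨fun u v => openSegment ℝ (f u) (f v), fun u v => openSegment_symm ℝ (f u) (f v)⟩

/-- The placement `f` of the vertices defines a straight-line drawing of `G`: distinct vertices
are distinct points, no three vertices are collinear, and no point lies in the interior of three
distinct edges. -/
structure IsStraightLineDrawing {V : Type*} (G : SimpleGraph V) (f : V → Plane) : Prop where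
  injective : Function.Injective f
  not_collinear : ∀ u v w : V, u ≠ v → u ≠ w → v ≠ w → ¬ Collinear ℝ {f u, f v, f w}
  no_triple_point : ∀ e₁ ∈ G.edgeSet, ∀ e₂ ∈ G.edgeSet, ∀ e₃ ∈ G.edgeSet,
    e₁ ≠ e₂ → e₁ ≠ e₃ → e₂ ≠ e₃ →
      edgeInterior f e₁ ∩ edgeInterior f e₂ ∩ edgeInterior f e₃ = ∅

/-- The set of unordered pairs of distinct edges of `G` whose interiors have a point in common,
when the vertices are placed by `f`. -/
def crossingPairs {V : Type*} (G : SimpleGraph V) (f : V → Plane) : Set (Sym2 (Sym2 V)) :=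
  {q | ∃ e₁ ∈ G.edgeSet, ∃ e₂ ∈ G.edgeSet, e₁ ≠ e₂ ∧
    (edgeInterior f e₁ ∩ edgeInterior f e₂).Nonempty ∧ q = s(e₁, e₂)}

/-- The rectilinear crossing number of a graph (for us: with finitely many vertices): the minimum
number of pairs of crossing edges in a straight-line drawing. -/
noncomputable def rectilinearCrossingNumber {V : Type*} (G : SimpleGraph V) : ℕ :=
  sInf {k | ∃ f : V → Plane, IsStraightLineDrawing G f ∧ (crossingPairs G f).ncard = k}

open Classical in
/-- `e_G(X, Y)`: the number of ordered pairs `(x, y)` with `x ∈ X`, `y ∈ Y` and `xy` an edge, so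
that an edge with both ends in `X ∩ Y` counts twice. -/
noncomputable def edgeCount {V : Type*} (G : SimpleGraph V) (X Y : Finset V) : ℕ :=
  (G.interedges X Y).card

/-- The sequence of graphs `G n` (on `n` vertices) is quasi-random with density `p`:
`e(X, Y) = p |X| |Y| + o(n ^ 2)` for all sets `X`, `Y` of vertices of `G n`, where the error term
is uniform in `X` and `Y`. -/
def IsQuasiRandom {V : ℕ → Type*} (G : ∀ n, SimpleGraph (V n)) (p : ℝ) : Prop :=
  ∀ ε : ℝ, 0 < ε → ∃ N : ℕ, ∀ n : ℕ, N ≤ n → ∀ X Y : Finset (V n),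
    |(edgeCount (G n) X Y : ℝ) - p * (X.card : ℝ) * (Y.card : ℝ)| ≤ ε * (n : ℝ) ^ 2

/-! The heart is a statement about every placement in general position: the edges of `G` have `p ^
2` times as many crossings as those of the complete graph, up to `o(n ^ 4)`, uniformly in the
placement (`GeneralPosition.abs_card_sub_le`).

Fix `c d`. A segment crossing it has one end on each side of its line, and whether such a segment
passes `c` on a given side depends only on comparing the angles at which its ends are seen from `c`;
the same holds for `d`. So the pairs `a b` crossing `c d` are described by a difference of two
threshold relations `φ a < ψ b`. Such a relation is a staircase: a bounded number of combinatorial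
rectangles plus a small remainder (`abs_sum_threshold_le`). Since `1_G - p` has small sums over
rectangles, it has small sum over the pairs crossing `c d` (`GeneralPosition.abs_sum_crosses_le`).
Replacing the indicator of `G` by `p` for one edge of each crossing pair, then for the other, gives
the count.

Applying this to an optimal drawing of `G` and to one of `K_n` bounds the difference of the crossing
numbers from both sides. The additive error becomes relative because `K_n` has order `n ^ 4`
crossings: any five points in general position span one (`GeneralPosition.exists_crosses`). -/

/-! ### Orientations and transversal crossing of segments. -/

/-- Twice the signed area of the triangle `x y z`. -/
def signedArea (x y z : Plane) : ℝ :=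
  (y 0 - x 0) * (z 1 - x 1) - (y 1 - x 1) * (z 0 - x 0)

/-- The four points satisfy the sign conditions under which the open segments `a b` and `c d`
cross transversally. -/
def Crosses (a b c d : Plane) : Prop :=
  signedArea a b c * signedArea a b d < 0 ∧ signedArea c d a * signedArea c d b < 0

/-- No three of the points `f v` with distinct labels are collinear. -/
def GeneralPosition {V : Type*} (f : V → Plane) : Prop :=
  ∀ u v w : V, u ≠ v → u ≠ w → v ≠ w → signedArea (f u) (f v) (f w) ≠ 0

theorem signedArea_eq_zero_of_collinear {x y z : Plane} (h : Collinear ℝ {x, y, z}) :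
    signedArea x y z = 0 := by
  obtain ⟨v, hv⟩ := (collinear_iff_of_mem (p₀ := x) (by simp)).1 h
  obtain ⟨r, hr⟩ := hv y (by simp)
  obtain ⟨s, hs⟩ := hv z (by simp)
  simp only [signedArea, hr, hs, vadd_eq_add, PiLp.add_apply, PiLp.smul_apply, smul_eq_mul]
  ring

theorem collinear_of_signedArea_eq_zero {x y z : Plane} (h : signedArea x y z = 0) :
    Collinear ℝ {x, y, z} := by
  by_cases hxy : x = y
  · subst hxy
    simpa using collinear_pair ℝ x z
  have hpos : 0 < (y 0 - x 0) ^ 2 + (y 1 - x 1) ^ 2 := by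
    by_contra hn
    apply hxy
    have h0 : y 0 - x 0 = 0 := by nlinarith [sq_nonneg (y 0 - x 0), sq_nonneg (y 1 - x 1)]
    have h1 : y 1 - x 1 = 0 := by nlinarith [sq_nonneg (y 0 - x 0), sq_nonneg (y 1 - x 1)]
    ext i
    fin_cases i
    · simp only [Fin.zero_eta]; linarith
    · simp only [Fin.mk_one]; linarith
  rw [collinear_iff_of_mem (p₀ := x) (by simp)]
  refine ⟨y - x, ?_⟩
  simp only [signedArea] at h
  rintro q (rfl | rfl | rfl)
  · exact ⟨0, by simp⟩
  · exact ⟨1, by simp⟩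
  · refine ⟨((y 0 - x 0) * (q 0 - x 0) + (y 1 - x 1) * (q 1 - x 1)) /
      ((y 0 - x 0) ^ 2 + (y 1 - x 1) ^ 2), ?_⟩
    ext i
    fin_cases i
    · simp only [Fin.zero_eta, vadd_eq_add, PiLp.add_apply, PiLp.smul_apply, PiLp.sub_apply,
        smul_eq_mul]
      field_simp
      linear_combination (-(y 1 - x 1)) * h
    · simp only [Fin.mk_one, vadd_eq_add, PiLp.add_apply, PiLp.smul_apply, PiLp.sub_apply,
        smul_eq_mul]
      field_simp
      linear_combination (y 0 - x 0) * h

theorem generalPosition_iff {V : Type*} (f : V → Plane) :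
    GeneralPosition f ↔
      ∀ u v w : V, u ≠ v → u ≠ w → v ≠ w → ¬ Collinear ℝ {f u, f v, f w} :=
  ⟨fun h u v w h1 h2 h3 hc => h u v w h1 h2 h3 (signedArea_eq_zero_of_collinear hc),
    fun h u v w h1 h2 h3 hc => h u v w h1 h2 h3 (collinear_of_signedArea_eq_zero hc)⟩

theorem signedArea_self_left (x y : Plane) : signedArea x x y = 0 := by
  simp only [signedArea]; ring

theorem signedArea_self_right (x y : Plane) : signedArea x y y = 0 := by
  simp only [signedArea]; ring

theorem signedArea_self_outer (x y : Plane) : signedArea x y x = 0 := by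
  simp only [signedArea]; ring

theorem signedArea_swap_left (x y z : Plane) : signedArea y x z = -signedArea x y z := by
  simp only [signedArea]; ring

/-- Both sides are the cross product of `b - a` with `c - d`. -/
theorem signedArea_four (a b c d : Plane) :
    signedArea a b c - signedArea a b d = signedArea c d b - signedArea c d a := by
  simp only [signedArea]; ring

namespace Crosses

variable {a b c d : Plane}

theorem swap (h : Crosses a b c d) : Crosses c d a b := ⟨h.2, h.1⟩

theorem swap_left (h : Crosses a b c d) : Crosses b a c d := by
  refine ⟨?_, by rw [mul_comm]; exact h.2⟩
  rw [signedArea_swap_left a b c, signedArea_swap_left a b d, neg_mul_neg]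
  exact h.1

theorem swap_right (h : Crosses a b c d) : Crosses a b d c := h.swap.swap_left.swap

theorem comm : Crosses a b c d ↔ Crosses c d a b := ⟨swap, swap⟩

theorem comm_left : Crosses a b c d ↔ Crosses b a c d := ⟨swap_left, swap_left⟩

theorem ne_fst (h : Crosses a b c d) : a ≠ b := by
  rintro rfl; simpa [signedArea_self_left] using h.1

theorem ne_snd (h : Crosses a b c d) : c ≠ d := h.swap.ne_fst

theorem ne_left (h : Crosses a b c d) : a ≠ c := by
  rintro rfl; simpa [signedArea_self_outer] using h.1

theorem ne_right (h : Crosses a b c d) : b ≠ d := h.swap_left.swap_right.ne_left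

theorem ne_left_right (h : Crosses a b c d) : a ≠ d := h.swap_right.ne_left

theorem ne_right_left (h : Crosses a b c d) : b ≠ c := h.swap_left.ne_left

/-- Transversal crossing implies that the open segments meet. -/
theorem nonempty_inter (h : Crosses a b c d) :
    (openSegment ℝ a b ∩ openSegment ℝ c d).Nonempty := by
  have aux : ∀ {u v : ℝ}, u * v < 0 →
      u - v ≠ 0 ∧ 0 < u / (u - v) ∧ 0 < -v / (u - v) := by
    intro u v huv
    rcases mul_neg_iff.1 huv with ⟨hu, hv⟩ | ⟨hu, hv⟩
    · have : 0 < u - v := by linarith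
      exact ⟨this.ne', div_pos hu this, div_pos (by linarith) this⟩
    · have : u - v < 0 := by linarith
      exact ⟨this.ne, div_pos_of_neg_of_neg hu this, div_pos_of_neg_of_neg (by linarith) this⟩
  obtain ⟨hn, h1, h2⟩ := aux h.1
  obtain ⟨hm, k1, k2⟩ := aux h.2
  have hmn := signedArea_four a b c d
  -- The affine function `signedArea c d` takes values `u`, `v` of opposite sign at `a`, `b`, so it
  -- vanishes at the combination with weights `-v / (u - v)` and `u / (u - v)`; likewise on `c d`.
  refine ⟨_, ⟨_, _, k2, k1, ?_, rfl⟩, ⟨_, _, h2, h1, ?_, ?_⟩⟩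
  · field_simp; ring
  · field_simp; ring
  · ext i
    simp only [PiLp.add_apply, PiLp.smul_apply, smul_eq_mul]
    have e : signedArea c d a - signedArea c d b = -(signedArea a b c - signedArea a b d) := by
      linarith
    rw [e]
    field_simp
    simp only [signedArea]
    fin_cases i
    · simp only [Fin.zero_eta]; ring
    · simp only [Fin.mk_one]; ring

end Crosses

theorem signedArea_combo (a b c d : Plane) {s t : ℝ} (h : s + t = 1) :
    signedArea a b (s • c + t • d) = s * signedArea a b c + t * signedArea a b d := by
  obtain rfl : t = 1 - s := by linarith
  simp only [signedArea, PiLp.add_apply, PiLp.smul_apply, smul_eq_mul]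
  ring

theorem signedArea_mem_openSegment {a b x : Plane} (h : x ∈ openSegment ℝ a b) :
    signedArea a b x = 0 := by
  obtain ⟨s, t, -, -, hst, rfl⟩ := h
  rw [signedArea_combo _ _ _ _ hst, signedArea_self_outer, signedArea_self_right]
  ring

/-- If the open segments `a b` and `c d` meet, then they cross transversally, unless an end of
one lies on the line of the other. -/
theorem crosses_of_nonempty_inter {a b c d : Plane}
    (h : (openSegment ℝ a b ∩ openSegment ℝ c d).Nonempty)
    (h1 : signedArea a b c ≠ 0 ∨ signedArea a b d ≠ 0)
    (h2 : signedArea c d a ≠ 0 ∨ signedArea c d b ≠ 0) :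
    Crosses a b c d := by
  have aux : ∀ {a b c d x : Plane}, x ∈ openSegment ℝ a b → x ∈ openSegment ℝ c d →
      (signedArea a b c ≠ 0 ∨ signedArea a b d ≠ 0) →
      signedArea a b c * signedArea a b d < 0 := by
    intro a b c d x hab hcd h
    have h0 := signedArea_mem_openSegment hab
    obtain ⟨s, t, hs, ht, hst, rfl⟩ := hcd
    rw [signedArea_combo _ _ _ _ hst] at h0
    generalize signedArea a b c = u at *
    generalize signedArea a b d = v at *
    obtain rfl : v = -(s * u) / t := by field_simp; linarith
    have hu : u ≠ 0 := by
      rintro rfl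
      simp at h
    have : u * (-(s * u) / t) = -(s * u ^ 2 / t) := by ring
    rw [this]
    have : 0 < u ^ 2 := by positivity
    have : 0 < s * u ^ 2 / t := by positivity
    linarith
  obtain ⟨x, hab, hcd⟩ := h
  exact ⟨aux hab hcd h1, aux hcd hab h2⟩

/-- Two edges of a drawing in general position cross if and only if the sign conditions hold. -/
theorem GeneralPosition.nonempty_inter_iff {V : Type*} {f : V → Plane} (hf : GeneralPosition f)
    {a b c d : V} (hab : a ≠ b) (hcd : c ≠ d) (hne : s(a, b) ≠ s(c, d)) :
    (openSegment ℝ (f a) (f b) ∩ openSegment ℝ (f c) (f d)).Nonempty ↔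
      Crosses (f a) (f b) (f c) (f d) := by
  refine ⟨fun h => ?_, fun h => h.nonempty_inter⟩
  simp only [ne_eq, Sym2.eq_iff, not_or, not_and] at hne
  apply crosses_of_nonempty_inter h
  -- If the edges share a vertex, one of the two areas is zero, but the remaining end is off the
  -- line.
  · by_cases h1 : a = c ∨ b = c
    · exact Or.inr (hf _ _ _ hab (by grind) (by grind))
    · exact Or.inl (hf _ _ _ hab (by grind) (by grind))
  · by_cases h1 : a = c ∨ a = d
    · exact Or.inr (hf _ _ _ hcd (by grind) (by grind))
    · exact Or.inl (hf _ _ _ hcd (by grind) (by grind))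

/-! ### Five points in general position span a crossing. -/

set_option synthInstance.maxHeartbeats 400000 in
set_option synthInstance.maxSize 4096 in
-- Here `bijk` stands for the orientation of the triple `ijk`. Each hypothesis is the constraint of
-- `sign_four` on four of the points, and each alternative says that some four are in convex
-- position, so the geometry reduces to a check of `2 ^ 10` cases.
theorem bool_five_point : ∀ b012 b013 b014 b023 b024 b034 b123 b124 b134 b234 : Bool,
    ¬ (b123 = !b023 ∧ b123 = b013 ∧ b123 = !b012) →
    ¬ (b124 = !b024 ∧ b124 = b014 ∧ b124 = !b012) →
    ¬ (b134 = !b034 ∧ b134 = b014 ∧ b134 = !b013) →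
    ¬ (b234 = !b034 ∧ b234 = b024 ∧ b234 = !b023) →
    ¬ (b234 = !b134 ∧ b234 = b124 ∧ b234 = !b123) →
    ((b012 ≠ b013 ∧ b023 ≠ b123) ∨ (b012 = b023 ∧ b013 = b123) ∨ (b013 ≠ b023 ∧ b012 ≠ b123)) ∨
    ((b012 ≠ b014 ∧ b024 ≠ b124) ∨ (b012 = b024 ∧ b014 = b124) ∨ (b014 ≠ b024 ∧ b012 ≠ b124)) ∨
    ((b013 ≠ b014 ∧ b034 ≠ b134) ∨ (b013 = b034 ∧ b014 = b134) ∨ (b014 ≠ b034 ∧ b013 ≠ b134)) ∨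
    ((b023 ≠ b024 ∧ b034 ≠ b234) ∨ (b023 = b034 ∧ b024 = b234) ∨ (b024 ≠ b034 ∧ b023 ≠ b234)) ∨
    ((b123 ≠ b124 ∧ b134 ≠ b234) ∨ (b123 = b134 ∧ b124 = b234) ∨
      (b124 ≠ b134 ∧ b123 ≠ b234)) := by
  decide +kernel

/-- The signs of the four triangles spanned by four points are not those of a positive
combination that vanishes. -/
theorem sign_four {a b c d : Plane} (hacd : signedArea a c d ≠ 0) :
    ¬ ((decide (0 < signedArea b c d) = !decide (0 < signedArea a c d)) ∧
      decide (0 < signedArea b c d) = decide (0 < signedArea a b d) ∧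
      decide (0 < signedArea b c d) = !decide (0 < signedArea a b c)) := by
  have h : signedArea b c d - signedArea a c d + signedArea a b d - signedArea a b c = 0 := by
    simp only [signedArea]; ring
  by_cases h1 : 0 < signedArea b c d <;> by_cases h2 : 0 < signedArea a c d <;>
    by_cases h3 : 0 < signedArea a b d <;> by_cases h4 : 0 < signedArea a b c <;>
    simp only [h1, h2, h3, h4, decide_true, decide_false, Bool.not_true, Bool.not_false,
      Bool.false_eq_true, Bool.true_eq_false, and_false, not_false_eq_true, and_true,
      not_true]
  · have h2' := lt_of_le_of_ne (not_lt.1 h2) hacd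
    linarith
  · linarith

theorem mul_neg_of_sign_ne {x y : ℝ} (hx : x ≠ 0) (hy : y ≠ 0)
    (h : decide (0 < x) ≠ decide (0 < y)) : x * y < 0 := by
  rcases lt_or_gt_of_ne hx with h1 | h1 <;> rcases lt_or_gt_of_ne hy with h2 | h2
  · simp [h1.not_gt, h2.not_gt] at h
  · exact mul_neg_of_neg_of_pos h1 h2
  · exact mul_neg_of_pos_of_neg h1 h2
  · simp [h1, h2] at h

theorem mul_pos_of_sign_eq {x y : ℝ} (hx : x ≠ 0) (hy : y ≠ 0)
    (h : decide (0 < x) = decide (0 < y)) : 0 < x * y := by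
  rcases lt_or_gt_of_ne hx with h1 | h1 <;> rcases lt_or_gt_of_ne hy with h2 | h2
  · exact mul_pos_of_neg_of_neg h1 h2
  · simp [h1.not_gt, h2] at h
  · simp [h1, h2.not_gt] at h
  · exact mul_pos h1 h2

/-- If the signs of the triangles spanned by `a b c d` are those of a convex quadrilateral, then
its diagonals cross. -/
theorem crosses_of_sign {a b c d : Plane} (h1 : signedArea a b c ≠ 0) (h2 : signedArea a b d ≠ 0)
    (h3 : signedArea a c d ≠ 0) (h4 : signedArea b c d ≠ 0)
    (h : (decide (0 < signedArea a b c) ≠ decide (0 < signedArea a b d) ∧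
        decide (0 < signedArea a c d) ≠ decide (0 < signedArea b c d)) ∨
      (decide (0 < signedArea a b c) = decide (0 < signedArea a c d) ∧
        decide (0 < signedArea a b d) = decide (0 < signedArea b c d)) ∨
      (decide (0 < signedArea a b d) ≠ decide (0 < signedArea a c d) ∧
        decide (0 < signedArea a b c) ≠ decide (0 < signedArea b c d))) :
    Crosses a b c d ∨ Crosses a c b d ∨ Crosses a d b c := by
  have e1 : signedArea c d a = signedArea a c d := by simp only [signedArea]; ring
  have e2 : signedArea c d b = signedArea b c d := by simp only [signedArea]; ring
  have e3 : signedArea a c b = -signedArea a b c := by simp only [signedArea]; ring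
  have e4 : signedArea b d a = signedArea a b d := by simp only [signedArea]; ring
  have e5 : signedArea b d c = -signedArea b c d := by simp only [signedArea]; ring
  have e6 : signedArea a d b = -signedArea a b d := by simp only [signedArea]; ring
  have e7 : signedArea a d c = -signedArea a c d := by simp only [signedArea]; ring
  have e8 : signedArea b c a = signedArea a b c := by simp only [signedArea]; ring
  unfold Crosses
  rw [e1, e2, e3, e4, e5, e6, e7, e8]
  -- One alternative for each way to pair the four points into diagonals.
  rcases h with ⟨ha, hb⟩ | ⟨ha, hb⟩ | ⟨ha, hb⟩
  · exact Or.inl ⟨mul_neg_of_sign_ne h1 h2 ha, mul_neg_of_sign_ne h3 h4 hb⟩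
  · have := mul_pos_of_sign_eq h1 h3 ha
    have := mul_pos_of_sign_eq h2 h4 hb
    exact Or.inr (Or.inl ⟨by linarith, by linarith⟩)
  · have := mul_neg_of_sign_ne h2 h3 ha
    have := mul_neg_of_sign_ne h1 h4 hb
    exact Or.inr (Or.inr ⟨by linarith, by linarith⟩)

/-- Among five points in general position, some four span two crossing segments. -/
theorem GeneralPosition.exists_crosses {f : Fin 5 → Plane} (hf : GeneralPosition f) :
    ∃ q : Fin 5 → Fin 5, Function.Surjective q ∧
      Crosses (f (q 0)) (f (q 1)) (f (q 2)) (f (q 3)) := by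
  let A : Fin 5 → Fin 5 → Fin 5 → ℝ := fun i j k => signedArea (f i) (f j) (f k)
  have D : ∀ i j k : Fin 5, (i ≠ j ∧ i ≠ k ∧ j ≠ k) → signedArea (f i) (f j) (f k) ≠ 0 :=
    fun i j k h => hf i j k h.1 h.2.1 h.2.2
  have four : ∀ i j k l m : Fin 5, (i ≠ j ∧ i ≠ k ∧ j ≠ k) → (i ≠ l ∧ j ≠ l ∧ k ≠ l) →
      Function.Surjective ![i, j, k, l, m] → Function.Surjective ![i, k, j, l, m] →
      Function.Surjective ![i, l, j, k, m] →
      ((decide (0 < A i j k) ≠ decide (0 < A i j l) ∧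
        decide (0 < A i k l) ≠ decide (0 < A j k l)) ∨
      (decide (0 < A i j k) = decide (0 < A i k l) ∧
        decide (0 < A i j l) = decide (0 < A j k l)) ∨
      (decide (0 < A i j l) ≠ decide (0 < A i k l) ∧
        decide (0 < A i j k) ≠ decide (0 < A j k l))) →
      ∃ q : Fin 5 → Fin 5, Function.Surjective q ∧
        Crosses (f (q 0)) (f (q 1)) (f (q 2)) (f (q 3)) := by
    intro i j k l m h1 h2 s1 s2 s3 h
    rcases crosses_of_sign (D i j k h1) (D i j l ⟨h1.1, h2.1, h2.2.1⟩)
      (D i k l ⟨h1.2.1, h2.1, h2.2.2⟩) (D j k l ⟨h1.2.2, h2.2.1, h2.2.2⟩) h with h | h | h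
    · exact ⟨_, s1, h⟩
    · exact ⟨_, s2, h⟩
    · exact ⟨_, s3, h⟩
  rcases bool_five_point _ _ _ _ _ _ _ _ _ _
    (sign_four (D 0 2 3 (by decide)))
    (sign_four (D 0 2 4 (by decide)))
    (sign_four (D 0 3 4 (by decide)))
    (sign_four (D 0 3 4 (by decide)))
    (sign_four (D 1 3 4 (by decide))) with h | h | h | h | h
  · exact four 0 1 2 3 4 (by decide) (by decide) (by decide) (by decide) (by decide) h
  · exact four 0 1 2 4 3 (by decide) (by decide) (by decide) (by decide) (by decide) h
  · exact four 0 1 3 4 2 (by decide) (by decide) (by decide) (by decide) (by decide) h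
  · exact four 0 2 3 4 1 (by decide) (by decide) (by decide) (by decide) (by decide) h
  · exact four 1 2 3 4 0 (by decide) (by decide) (by decide) (by decide) (by decide) h

/-! ### Generic placements are drawings of every graph. -/

/-- By the identity theorem, a single nonzero value excludes vanishing on an open set. Each
genericity condition therefore needs only one example. -/
theorem AnalyticOnNhd.dense_ne_zero {E : Type*} [NormedAddCommGroup E] [NormedSpace ℝ E]
    {F : E → ℝ} (hF : AnalyticOnNhd ℝ F Set.univ) {x₀ : E} (h₀ : F x₀ ≠ 0) :
    Dense {x | F x ≠ 0} := by
  intro x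
  by_contra hx
  rw [mem_closure_iff_frequently, Filter.not_frequently] at hx
  have := hF.eqOn_zero_of_preconnected_of_eventuallyEq_zero isPreconnected_univ (Set.mem_univ x)
    (by filter_upwards [hx] with y hy using not_not.1 hy)
  exact h₀ (this (Set.mem_univ x₀))

theorem AnalyticOnNhd.isOpen_ne_zero {E : Type*} [NormedAddCommGroup E] [NormedSpace ℝ E]
    {F : E → ℝ} (hF : AnalyticOnNhd ℝ F Set.univ) : IsOpen {x | F x ≠ 0} :=
  isOpen_ne_fun (continuousOn_univ.1 hF.continuousOn) continuous_const

/-- A quantity that vanishes when the lines `a b`, `c d` and `e g` have a common point. -/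
def concurrency (a b c d e g : Plane) : ℝ :=
  signedArea a b c * signedArea e g d - signedArea a b d * signedArea e g c

/-- Along `c d` both `signedArea a b` and `signedArea e g` are affine; a common zero makes the
determinant of their values at `c` and `d` vanish. -/
theorem concurrency_eq_zero {a b c d e g x : Plane} (h1 : x ∈ openSegment ℝ a b)
    (h2 : x ∈ openSegment ℝ c d) (h3 : x ∈ openSegment ℝ e g) :
    concurrency a b c d e g = 0 := by
  have k1 := signedArea_mem_openSegment h1
  have k3 := signedArea_mem_openSegment h3
  obtain ⟨s, t, hs, ht, hst, rfl⟩ := h2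
  rw [signedArea_combo _ _ _ _ hst] at k1 k3
  have : s * concurrency a b c d e g = 0 := by
    simp only [concurrency]
    linear_combination signedArea e g d * k1 - signedArea a b d * k3
  exact (mul_eq_zero.1 this).resolve_left hs.ne'

/-- Three edges through one point cross pairwise transversally, so their six ends are distinct, and
only such six-tuples need be excluded. -/
theorem isStraightLineDrawing_of_forall_ne {V : Type*} {f : V → Plane} (hinj : Function.Injective f)
    (hgen : GeneralPosition f)
    (hcon : ∀ a b c d e g : V, [a, b, c, d, e, g].Nodup →
      concurrency (f a) (f b) (f c) (f d) (f e) (f g) ≠ 0) (G : SimpleGraph V) :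
    IsStraightLineDrawing G f := by
  refine ⟨hinj, (generalPosition_iff f).1 hgen, ?_⟩
  intro e₁ he₁ e₂ he₂ e₃ he₃ h12 h13 h23
  induction e₁ with | _ a b
  induction e₂ with | _ c d
  induction e₃ with | _ e g
  rw [Set.eq_empty_iff_forall_notMem]
  rintro x ⟨⟨h1, h2⟩, h3⟩
  have nab := G.ne_of_adj he₁
  have ncd := G.ne_of_adj he₂
  have neg := G.ne_of_adj he₃
  have c12 := (hgen.nonempty_inter_iff nab ncd h12).1 ⟨x, h1, h2⟩
  have c13 := (hgen.nonempty_inter_iff nab neg h13).1 ⟨x, h1, h3⟩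
  have c23 := (hgen.nonempty_inter_iff ncd neg h23).1 ⟨x, h2, h3⟩
  have key : ∀ {a b c d : V}, Crosses (f a) (f b) (f c) (f d) →
      a ≠ c ∧ a ≠ d ∧ b ≠ c ∧ b ≠ d := fun h =>
    ⟨fun e => h.ne_left (e ▸ rfl), fun e => h.ne_left_right (e ▸ rfl),
      fun e => h.ne_right_left (e ▸ rfl), fun e => h.ne_right (e ▸ rfl)⟩
  have k12 := key c12
  have k13 := key c13
  have k23 := key c23
  exact hcon a b c d e g (by simp; tauto) (concurrency_eq_zero h1 h2 h3)

section Perturbation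

variable {V : Type*} [Fintype V]

theorem analyticOnNhd_coord (v : V) (i : Fin 2) :
    AnalyticOnNhd ℝ (fun f : V → Plane => f v i) Set.univ :=
  ((EuclideanSpace.proj (𝕜 := ℝ) i).comp
    (ContinuousLinearMap.proj (R := ℝ) (φ := fun _ : V => Plane) v)).analyticOnNhd _

theorem analyticOnNhd_signedArea (u v w : V) :
    AnalyticOnNhd ℝ (fun f : V → Plane => signedArea (f u) (f v) (f w)) Set.univ := by
  have h := analyticOnNhd_coord (V := V)
  exact (((h v 0).sub (h u 0)).mul ((h w 1).sub (h u 1))).sub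
    (((h v 1).sub (h u 1)).mul ((h w 0).sub (h u 0)))

theorem analyticOnNhd_concurrency (a b c d e g : V) :
    AnalyticOnNhd ℝ (fun f : V → Plane => concurrency (f a) (f b) (f c) (f d) (f e) (f g))
      Set.univ := by
  have h := analyticOnNhd_signedArea (V := V)
  exact ((h a b c).mul (h e g d)).sub ((h a b d).mul (h e g c))

/-- General position is vacuous for two vertices, so injectivity is a separate condition. -/
theorem dense_injective : Dense {f : V → Plane | Function.Injective f} := by
  classical
  have : Dense (⋂ i : {i : V × V // i.1 ≠ i.2},
      {f : V → Plane | f i.1.1 0 - f i.1.2 0 ≠ 0}) := by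
    have han := fun i : {i : V × V // i.1 ≠ i.2} =>
      (analyticOnNhd_coord i.1.1 0).sub (analyticOnNhd_coord i.1.2 0)
    refine dense_iInter_of_isOpen (fun i => (han i).isOpen_ne_zero) fun i =>
      (han i).dense_ne_zero (x₀ := fun v => if v = i.1.1 then !₂[1, 0] else 0) ?_
    simp [i.2.symm]
  refine this.mono fun f hf u v huv => ?_
  by_contra hne
  exact (Set.mem_iInter.1 hf) ⟨(u, v), hne⟩ (by simp [huv])

/-- Every placement of finitely many points can be perturbed into a straight-line drawing of
every graph on them. -/
theorem dense_isStraightLineDrawing :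
    Dense {f : V → Plane | ∀ G : SimpleGraph V, IsStraightLineDrawing G f} := by
  classical
  have hgo : ∀ i : {i : V × V × V // i.1 ≠ i.2.1 ∧ i.1 ≠ i.2.2 ∧ i.2.1 ≠ i.2.2},
      IsOpen {f : V → Plane | signedArea (f i.1.1) (f i.1.2.1) (f i.1.2.2) ≠ 0} :=
    fun i => (analyticOnNhd_signedArea _ _ _).isOpen_ne_zero
  have hg : Dense (⋂ i : {i : V × V × V // i.1 ≠ i.2.1 ∧ i.1 ≠ i.2.2 ∧ i.2.1 ≠ i.2.2},
      {f : V → Plane | signedArea (f i.1.1) (f i.1.2.1) (f i.1.2.2) ≠ 0}) := by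
    refine dense_iInter_of_isOpen hgo ?_
    rintro ⟨⟨u, v, w⟩, h1, h2, h3⟩
    refine (analyticOnNhd_signedArea u v w).dense_ne_zero
      (x₀ := fun z => if z = v then !₂[1, 0] else if z = w then !₂[0, 1] else 0) ?_
    dsimp only at h1 h2 h3
    simp [signedArea, h1, h2, h3.symm]
  have hco : ∀ i : {i : V × V × V × V × V × V // [i.1, i.2.1, i.2.2.1, i.2.2.2.1, i.2.2.2.2.1,
        i.2.2.2.2.2].Nodup},
      IsOpen {f : V → Plane | concurrency (f i.1.1) (f i.1.2.1) (f i.1.2.2.1) (f i.1.2.2.2.1)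
        (f i.1.2.2.2.2.1) (f i.1.2.2.2.2.2) ≠ 0} :=
    fun i => (analyticOnNhd_concurrency _ _ _ _ _ _).isOpen_ne_zero
  have hc : Dense (⋂ i : {i : V × V × V × V × V × V // [i.1, i.2.1, i.2.2.1, i.2.2.2.1,
        i.2.2.2.2.1, i.2.2.2.2.2].Nodup},
      {f : V → Plane | concurrency (f i.1.1) (f i.1.2.1) (f i.1.2.2.1) (f i.1.2.2.2.1)
        (f i.1.2.2.2.2.1) (f i.1.2.2.2.2.2) ≠ 0}) := by
    refine dense_iInter_of_isOpen hco ?_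
    rintro ⟨⟨a, b, c, d, e, g⟩, h⟩
    -- The three lines become the sides of a triangle: the two axes and the line through `(1, 0)`
    -- and `(0, 1)`.
    refine (analyticOnNhd_concurrency a b c d e g).dense_ne_zero
      (x₀ := fun z => if z = b ∨ z = e then !₂[1, 0] else if z = d ∨ z = g then !₂[0, 1] else 0)
      ?_
    simp only [List.nodup_cons, List.mem_cons, List.not_mem_nil, or_false, not_or] at h
    obtain ⟨⟨ab, ac, ad, ae, ag⟩, ⟨bc, bd, be, bg⟩, ⟨cd, ce, cg⟩, ⟨de, dg⟩, eg, -⟩ := h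
    simp [concurrency, signedArea, ab, ad, ae, ag, Ne.symm bc, Ne.symm bd, Ne.symm be,
      Ne.symm bg, cd, ce, cg, de, Ne.symm eg]
  have := (dense_injective (V := V)).inter_of_isOpen_right
    (hg.inter_of_isOpen_left hc (isOpen_iInter_of_finite hgo))
    ((isOpen_iInter_of_finite hgo).inter (isOpen_iInter_of_finite hco))
  refine this.mono ?_
  rintro f ⟨hinj, hgen, hcon⟩ G
  exact isStraightLineDrawing_of_forall_ne hinj
    (fun u v w h1 h2 h3 => Set.mem_iInter.1 hgen ⟨(u, v, w), h1, h2, h3⟩)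
    (fun a b c d e g h => Set.mem_iInter.1 hcon ⟨(a, b, c, d, e, g), h⟩) G

/-- Points in general position can be perturbed into a drawing of every graph without changing
the crossing relation. -/
theorem GeneralPosition.exists_perturbation {f : V → Plane} (hf : GeneralPosition f) :
    ∃ f' : V → Plane, (∀ G : SimpleGraph V, IsStraightLineDrawing G f') ∧
      ∀ a b c d : V, Crosses (f' a) (f' b) (f' c) (f' d) → Crosses (f a) (f b) (f c) (f d) := by
  -- The placements with the same triangle orientations as `f` form an open neighbourhood of `f`,
  -- and `Crosses` depends only on these orientations.
  have hopen : IsOpen (⋂ i : {i : V × V × V // i.1 ≠ i.2.1 ∧ i.1 ≠ i.2.2 ∧ i.2.1 ≠ i.2.2},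
      {f' : V → Plane | 0 < signedArea (f' i.1.1) (f' i.1.2.1) (f' i.1.2.2) *
        signedArea (f i.1.1) (f i.1.2.1) (f i.1.2.2)}) :=
    isOpen_iInter_of_finite fun i => isOpen_lt continuous_const
      ((continuousOn_univ.1 (analyticOnNhd_signedArea _ _ _).continuousOn).mul continuous_const)
  obtain ⟨f', hmem, hf'⟩ := (dense_isStraightLineDrawing (V := V)).inter_open_nonempty _ hopen
    ⟨f, Set.mem_iInter.2 fun i => mul_self_pos.2 (hf _ _ _ i.2.1 i.2.2.1 i.2.2.2)⟩
  refine ⟨f', hf', fun a b c d h => ?_⟩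
  have pos : ∀ u v w : V, u ≠ v → u ≠ w → v ≠ w →
      0 < signedArea (f' u) (f' v) (f' w) * signedArea (f u) (f v) (f w) :=
    fun u v w h1 h2 h3 => Set.mem_iInter.1 hmem ⟨(u, v, w), h1, h2, h3⟩
  have ab : a ≠ b := fun e => h.ne_fst (e ▸ rfl)
  have cd : c ≠ d := fun e => h.ne_snd (e ▸ rfl)
  have ac : a ≠ c := fun e => h.ne_left (e ▸ rfl)
  have ad : a ≠ d := fun e => h.ne_left_right (e ▸ rfl)
  have bc : b ≠ c := fun e => h.ne_right_left (e ▸ rfl)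
  have bd : b ≠ d := fun e => h.ne_right (e ▸ rfl)
  have aux : ∀ {x y x' y' : ℝ}, 0 < x' * x → 0 < y' * y → x' * y' < 0 → x * y < 0 := by
    intro x y x' y' h1 h2 h3
    by_contra h4
    have := mul_pos h1 h2
    nlinarith
  exact ⟨aux (pos a b c ab ac bc) (pos a b d ab ad bd) h.1,
    aux (pos c d a cd ac.symm ad.symm) (pos c d b cd bc.symm bd.symm) h.2⟩

end Perturbation

/-! ### Counting crossings by ordered quadruples. -/

theorem IsStraightLineDrawing.generalPosition {V : Type*} {G : SimpleGraph V} {f : V → Plane}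
    (h : IsStraightLineDrawing G f) : GeneralPosition f :=
  (generalPosition_iff f).2 h.not_collinear

section Counting

variable {V : Type*} [Fintype V]

open Classical in
/-- The ordered quadruples `(a, b, c, d)` such that `a b` and `c d` are crossing edges of `G`. -/
noncomputable def crossingQuadruples (G : SimpleGraph V) (f : V → Plane) :
    Finset (V × V × V × V) :=
  {q | G.Adj q.1 q.2.1 ∧ G.Adj q.2.2.1 q.2.2.2 ∧ Crosses (f q.1) (f q.2.1) (f q.2.2.1) (f q.2.2.2)}

theorem mem_crossingQuadruples {G : SimpleGraph V} {f : V → Plane} {a b c d : V} :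
    (a, b, c, d) ∈ crossingQuadruples G f ↔
      G.Adj a b ∧ G.Adj c d ∧ Crosses (f a) (f b) (f c) (f d) := by
  simp [crossingQuadruples]

/-- A pair of crossing edges gives rise to eight ordered quadruples of vertices. -/
theorem card_crossingQuadruples {f : V → Plane} (hf : GeneralPosition f) (G : SimpleGraph V) :
    (crossingQuadruples G f).card = (crossingPairs G f).ncard * 8 := by
  classical
  let φ : V × V × V × V → Sym2 (Sym2 V) := fun q => s(s(q.1, q.2.1), s(q.2.2.1, q.2.2.2))
  have himage : crossingPairs G f = ((crossingQuadruples G f).image φ : Finset _) := by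
    ext q
    simp only [crossingPairs, Set.mem_ofPred_eq, Finset.coe_image, Set.mem_image, Finset.mem_coe]
    constructor
    · rintro ⟨e₁, h1, e₂, h2, hne, hx, rfl⟩
      induction e₁ with | _ a b
      induction e₂ with | _ c d
      exact ⟨(a, b, c, d), mem_crossingQuadruples.2 ⟨h1, h2,
        (hf.nonempty_inter_iff (G.ne_of_adj h1) (G.ne_of_adj h2) hne).1 hx⟩, rfl⟩
    · rintro ⟨⟨a, b, c, d⟩, h, rfl⟩
      obtain ⟨h1, h2, h3⟩ := mem_crossingQuadruples.1 h
      refine ⟨s(a, b), h1, s(c, d), h2, fun e => ?_, h3.nonempty_inter, rfl⟩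
      rcases Sym2.eq_iff.1 e with ⟨e, -⟩ | ⟨e, -⟩
      · exact h3.ne_left (e ▸ rfl)
      · exact h3.ne_left_right (e ▸ rfl)
  rw [himage, Set.ncard_coe_finset, Finset.card_eq_sum_card_image φ]
  refine Finset.sum_const_nat fun q hq => ?_
  obtain ⟨⟨a, b, c, d⟩, h, rfl⟩ := Finset.mem_image.1 hq
  obtain ⟨h1, h2, h3⟩ := mem_crossingQuadruples.1 h
  have ab : a ≠ b := fun e => h3.ne_fst (e ▸ rfl)
  have cd : c ≠ d := fun e => h3.ne_snd (e ▸ rfl)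
  have ac : a ≠ c := fun e => h3.ne_left (e ▸ rfl)
  have ad : a ≠ d := fun e => h3.ne_left_right (e ▸ rfl)
  have bc : b ≠ c := fun e => h3.ne_right_left (e ▸ rfl)
  have bd : b ≠ d := fun e => h3.ne_right (e ▸ rfl)
  have hfib : {x ∈ crossingQuadruples G f | φ x = φ (a, b, c, d)} =
      ({(a, b, c, d), (b, a, c, d), (a, b, d, c), (b, a, d, c),
        (c, d, a, b), (d, c, a, b), (c, d, b, a), (d, c, b, a)} : Finset (V × V × V × V)) := by
    ext ⟨x, y, z, w⟩
    simp only [Finset.mem_filter, Finset.mem_insert, Finset.mem_singleton, Prod.mk.injEq, φ,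
      Sym2.eq_iff]
    constructor
    · rintro ⟨-, ⟨⟨rfl, rfl⟩ | ⟨rfl, rfl⟩, ⟨rfl, rfl⟩ | ⟨rfl, rfl⟩⟩ |
        ⟨⟨rfl, rfl⟩ | ⟨rfl, rfl⟩, ⟨rfl, rfl⟩ | ⟨rfl, rfl⟩⟩⟩ <;> simp only [and_self, true_or, or_true]
    · have k1 := h1.symm
      have k2 := h2.symm
      rintro (⟨rfl, rfl, rfl, rfl⟩ | ⟨rfl, rfl, rfl, rfl⟩ | ⟨rfl, rfl, rfl, rfl⟩ |
        ⟨rfl, rfl, rfl, rfl⟩ | ⟨rfl, rfl, rfl, rfl⟩ | ⟨rfl, rfl, rfl, rfl⟩ |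
        ⟨rfl, rfl, rfl, rfl⟩ | ⟨rfl, rfl, rfl, rfl⟩)
      · exact ⟨mem_crossingQuadruples.2 ⟨h1, h2, h3⟩, by simp⟩
      · exact ⟨mem_crossingQuadruples.2 ⟨k1, h2, h3.swap_left⟩, by simp⟩
      · exact ⟨mem_crossingQuadruples.2 ⟨h1, k2, h3.swap_right⟩, by simp⟩
      · exact ⟨mem_crossingQuadruples.2 ⟨k1, k2, h3.swap_left.swap_right⟩, by simp⟩
      · exact ⟨mem_crossingQuadruples.2 ⟨h2, h1, h3.swap⟩, by simp⟩
      · exact ⟨mem_crossingQuadruples.2 ⟨k2, h1, h3.swap.swap_left⟩, by simp⟩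
      · exact ⟨mem_crossingQuadruples.2 ⟨h2, k1, h3.swap.swap_right⟩, by simp⟩
      · exact ⟨mem_crossingQuadruples.2 ⟨k2, k1, h3.swap.swap_left.swap_right⟩, by simp⟩
  rw [hfib]
  simp [Finset.card_insert_of_notMem, ab, cd, ac, ad, bc, bd, ab.symm, cd.symm, ac.symm, ad.symm,
    bc.symm, bd.symm]

/-- The infimum is attained because generic placements give a drawing, so it is not the default
value `sInf ∅ = 0`. -/
theorem exists_drawing_card_eq (G : SimpleGraph V) :
    ∃ f : V → Plane, IsStraightLineDrawing G f ∧
      (crossingQuadruples G f).card = rectilinearCrossingNumber G * 8 := by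
  obtain ⟨f₀, h₀⟩ := (dense_isStraightLineDrawing (V := V)).nonempty
  obtain ⟨f, hf, hk⟩ := Nat.sInf_mem
    (s := {k | ∃ f : V → Plane, IsStraightLineDrawing G f ∧ (crossingPairs G f).ncard = k})
    ⟨_, f₀, h₀ G, rfl⟩
  exact ⟨f, hf, by rw [card_crossingQuadruples hf.generalPosition, hk]; rfl⟩

theorem rectilinearCrossingNumber_le {G : SimpleGraph V} {f : V → Plane}
    (hf : IsStraightLineDrawing G f) :
    rectilinearCrossingNumber G * 8 ≤ (crossingQuadruples G f).card := by
  rw [card_crossingQuadruples hf.generalPosition]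
  exact Nat.mul_le_mul_right _ (Nat.sInf_le ⟨f, hf, rfl⟩)

theorem card_crossingQuadruples_top_comp {W : Type*} [Fintype W] (σ : W ≃ V) (f : V → Plane) :
    (crossingQuadruples ⊤ (f ∘ σ)).card = (crossingQuadruples ⊤ f).card := by
  refine Finset.card_equiv (σ.prodCongr (σ.prodCongr (σ.prodCongr σ))) ?_
  rintro ⟨a, b, c, d⟩
  simp [mem_crossingQuadruples]

/-- In terms of any placement in general position, `K_n` has at least `cr(K_n)` crossings. -/
theorem GeneralPosition.rectilinearCrossingNumber_top_le {f : V → Plane} (hf : GeneralPosition f) :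
    rectilinearCrossingNumber (⊤ : SimpleGraph V) * 8 ≤ (crossingQuadruples ⊤ f).card := by
  obtain ⟨f', hf', hcr⟩ := hf.exists_perturbation
  refine (rectilinearCrossingNumber_le (hf' ⊤)).trans (Finset.card_le_card ?_)
  rintro ⟨a, b, c, d⟩ h
  rw [mem_crossingQuadruples] at h ⊢
  exact ⟨h.1, h.2.1, hcr _ _ _ _ h.2.2⟩

theorem rectilinearCrossingNumber_top_le_of_equiv {W : Type*} [Fintype W] (σ : W ≃ V) :
    rectilinearCrossingNumber (⊤ : SimpleGraph W) ≤
      rectilinearCrossingNumber (⊤ : SimpleGraph V) := by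
  obtain ⟨f, hf, hcard⟩ := exists_drawing_card_eq (⊤ : SimpleGraph V)
  have hgen : GeneralPosition (f ∘ σ) := fun u v w h1 h2 h3 =>
    hf.generalPosition _ _ _ (σ.injective.ne h1) (σ.injective.ne h2) (σ.injective.ne h3)
  have := hgen.rectilinearCrossingNumber_top_le
  rw [card_crossingQuadruples_top_comp, hcard] at this
  exact Nat.le_of_mul_le_mul_right this (by norm_num)

theorem rectilinearCrossingNumber_top_congr {W : Type*} [Fintype W] (σ : W ≃ V) :
    rectilinearCrossingNumber (⊤ : SimpleGraph W) =
      rectilinearCrossingNumber (⊤ : SimpleGraph V) :=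
  le_antisymm (rectilinearCrossingNumber_top_le_of_equiv σ)
    (rectilinearCrossingNumber_top_le_of_equiv σ.symm)

/-- Every five points span a crossing, so a positive proportion of all quadruples cross. -/
theorem GeneralPosition.descFactorial_le {f : V → Plane} (hf : GeneralPosition f) :
    (Fintype.card V).descFactorial 5 ≤
      5 ^ 5 * ((crossingQuadruples ⊤ f).card * Fintype.card V) := by
  classical
  -- Five-tuples are sorted by the labelling `q` that exhibits a crossing, at most `5 ^ 5` classes.
  -- Since `q` is surjective, a tuple in a class is recovered from its crossing quadruple and one
  -- further vertex.
  let S : (Fin 5 → Fin 5) → Finset (Fin 5 ↪ V) := fun q =>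
    Finset.univ.filter fun x => Function.Surjective q ∧
      Crosses (f (x (q 0))) (f (x (q 1))) (f (x (q 2))) (f (x (q 3)))
  have hcover : (Finset.univ : Finset (Fin 5 ↪ V)) ⊆ Finset.univ.biUnion S := by
    intro x _
    have hx : GeneralPosition (f ∘ x) := fun u v w h1 h2 h3 =>
      hf _ _ _ (x.injective.ne h1) (x.injective.ne h2) (x.injective.ne h3)
    obtain ⟨q, hq, hc⟩ := hx.exists_crosses
    refine Finset.mem_biUnion.2 ⟨q, Finset.mem_univ _, Finset.mem_filter.2 ⟨Finset.mem_univ _, hq, hc⟩⟩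
  have hS : ∀ q ∈ (Finset.univ : Finset (Fin 5 → Fin 5)),
      (S q).card ≤ (crossingQuadruples ⊤ f).card * Fintype.card V := by
    intro q _
    rw [← Finset.card_univ, ← Finset.card_product]
    refine Finset.card_le_card_of_injOn
      (fun x => ((x (q 0), x (q 1), x (q 2), x (q 3)), x (q 4))) ?_ ?_
    · intro x hx
      have hx := (Finset.mem_filter.1 (Finset.mem_coe.1 hx)).2.2
      refine Finset.mem_coe.2 (Finset.mem_product.2 ⟨mem_crossingQuadruples.2 ⟨?_, ?_, hx⟩,
        Finset.mem_univ _⟩)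
      · exact fun e => hx.ne_fst (congrArg f e)
      · exact fun e => hx.ne_snd (congrArg f e)
    · intro x hx y _ hxy
      have hq := (Finset.mem_filter.1 (Finset.mem_coe.1 hx)).2.1
      simp only [Prod.mk.injEq] at hxy
      obtain ⟨⟨h0, h1, h2, h3⟩, h4⟩ := hxy
      ext i
      obtain ⟨j, rfl⟩ := hq i
      fin_cases j <;> assumption
  have h := (Finset.card_le_card hcover).trans (Finset.card_biUnion_le_card_mul _ _ _ hS)
  simpa [Fintype.card_embedding_eq] using h

end Counting

/-! ### Threshold relations as staircases of rectangles. -/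

section Threshold

variable {α β : Type*}

theorem Finset.exists_subset_card_eq_forall_le [DecidableEq α] (φ : α → ℝ) (L : Finset α) {j : ℕ}
    (hj : j ≤ L.card) :
    ∃ M ⊆ L, M.card = j ∧ ∀ a ∈ M, ∀ a' ∈ L \ M, φ a ≤ φ a' := by
  induction j with
  | zero => exact ⟨∅, by simp⟩
  | succ j ih =>
    obtain ⟨M, hML, hcard, hM⟩ := ih (by omega)
    have hne : (L \ M).Nonempty := by
      rw [← Finset.card_pos, Finset.card_sdiff_of_subset hML]
      omega
    obtain ⟨x, hx, hmin⟩ := Finset.exists_min_image (L \ M) φ hne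
    obtain ⟨hxL, hxM⟩ := Finset.mem_sdiff.1 hx
    refine ⟨insert x M, Finset.insert_subset hxL hML,
      by rw [Finset.card_insert_of_notMem hxM, hcard], fun a ha a' ha' => ?_⟩
    have ha'' : a' ∈ L \ M := by
      simp only [Finset.mem_sdiff, Finset.mem_insert, not_or] at ha' ⊢
      exact ⟨ha'.1, ha'.2.2⟩
    rcases Finset.mem_insert.1 ha with rfl | ha
    · exact hmin _ ha''
    · exact hM a ha a' ha''

/-- If the sums of `w` over all combinatorial rectangles are at most `E`, then its sums over
threshold relations are small as well. -/
theorem abs_sum_threshold_le {w : α → β → ℝ} (hw : ∀ a b, |w a b| ≤ 1) {E : ℝ}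
    (hE : ∀ (X : Finset α) (Y : Finset β), |∑ a ∈ X, ∑ b ∈ Y, w a b| ≤ E)
    (φ : α → ℝ) (ψ : β → ℝ) (m k : ℕ) (L : Finset α) (R : Finset β) (hL : L.card ≤ k * m) :
    |∑ a ∈ L, ∑ b ∈ R, if φ a < ψ b then w a b else 0| ≤ k * E + m * R.card := by
  classical
  induction k generalizing L R with
  | zero =>
    have : L = ∅ := by simpa using hL
    subst this
    simp only [Finset.sum_empty, abs_zero, Nat.cast_zero, zero_mul, zero_add]
    positivity
  | succ k ih =>
    -- Peel off the (at most `m`) elements of least `φ` and split `R` by whether `b` is related to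
    -- all of `M`. Then `M × R₁` is a full rectangle, `(L \ M) × R₂` contains no related pair, `(L \
    -- M) × R₁` is left to induction, and `M × R₂` is bounded trivially. The sets `R₂` of successive
    -- steps are disjoint, so the trivial bounds add up to at most `m * R.card`.
    obtain ⟨M, hML, hcard, hM⟩ := L.exists_subset_card_eq_forall_le φ (min_le_right m L.card)
    set R₁ := R.filter fun b => ∀ a ∈ M, φ a < ψ b with hR₁
    set R₂ := R.filter fun b => ¬ ∀ a ∈ M, φ a < ψ b with hR₂
    set t : α → β → ℝ := fun a b => if φ a < ψ b then w a b else 0 with ht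
    have hsplit : ∑ a ∈ L, ∑ b ∈ R, t a b = ∑ a ∈ M, ∑ b ∈ R₁, w a b +
        ∑ a ∈ L \ M, ∑ b ∈ R₁, t a b + ∑ a ∈ M, ∑ b ∈ R₂, t a b := by
      have h1 : ∀ a, ∑ b ∈ R, t a b = ∑ b ∈ R₁, t a b + ∑ b ∈ R₂, t a b := fun a =>
        (Finset.sum_filter_add_sum_filter_not R _ _).symm
      have h2 : ∑ a ∈ L \ M, ∑ b ∈ R₂, t a b = 0 := by
        refine Finset.sum_eq_zero fun a ha => Finset.sum_eq_zero fun b hb => if_neg ?_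
        obtain ⟨-, hb⟩ := Finset.mem_filter.1 hb
        push Not at hb
        obtain ⟨a', ha', hle⟩ := hb
        exact not_lt.2 (hle.trans (hM a' ha' a ha))
      have h3 : ∑ a ∈ M, ∑ b ∈ R₁, t a b = ∑ a ∈ M, ∑ b ∈ R₁, w a b :=
        Finset.sum_congr rfl fun a ha => Finset.sum_congr rfl fun b hb =>
          if_pos ((Finset.mem_filter.1 hb).2 a ha)
      rw [← Finset.sum_sdiff hML]
      simp only [h1, Finset.sum_add_distrib, h2, h3]
      ring
    have b1 := hE M R₁
    have hLM : (L \ M).card ≤ k * m := by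
      rw [Finset.card_sdiff_of_subset hML, hcard]
      rw [Nat.succ_mul] at hL
      omega
    have b2 := ih (L \ M) R₁ hLM
    have b3 : |∑ a ∈ M, ∑ b ∈ R₂, t a b| ≤ m * R₂.card := by
      have h1 : ∀ a b, |t a b| ≤ 1 := by
        intro a b
        simp only [ht]
        split_ifs
        · exact hw a b
        · simp
      calc |∑ a ∈ M, ∑ b ∈ R₂, t a b| ≤ ∑ a ∈ M, ∑ b ∈ R₂, |t a b| :=
            (Finset.abs_sum_le_sum_abs _ _).trans
              (Finset.sum_le_sum fun a _ => Finset.abs_sum_le_sum_abs _ _)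
        _ ≤ ∑ a ∈ M, ∑ b ∈ R₂, (1 : ℝ) :=
            Finset.sum_le_sum fun a _ => Finset.sum_le_sum fun b _ => h1 a b
        _ = M.card * R₂.card := by simp
        _ ≤ m * R₂.card := by
            gcongr
            omega
    have hR : (R.card : ℝ) = R₁.card + R₂.card := by
      rw [← Nat.cast_add, Finset.card_filter_add_card_filter_not]
    rw [hsplit, hR]
    push_cast
    have b4 := abs_add_three (∑ a ∈ M, ∑ b ∈ R₁, w a b) (∑ a ∈ L \ M, ∑ b ∈ R₁, t a b)
      (∑ a ∈ M, ∑ b ∈ R₂, t a b)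
    linarith

end Threshold

/-! ### Crossings in a graph of small discrepancy. -/

/-- For points `a`, `b` on different sides of the line `c d` and a point `e` of this line, the
sign of the triangle `a b e` is a threshold relation between `a` and `b`. -/
theorem signedArea_neg_iff {a b c d e : Plane} (he : signedArea c d e = 0)
    (ha : 0 < signedArea c d a) (hb : signedArea c d b < 0) :
    signedArea a b e < 0 ↔
      -((d 0 - c 0) * (a 0 - e 0) + (d 1 - c 1) * (a 1 - e 1)) / signedArea c d a <
      -((d 0 - c 0) * (b 0 - e 0) + (d 1 - c 1) * (b 1 - e 1)) / signedArea c d b := by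
  set ga := (d 0 - c 0) * (a 0 - e 0) + (d 1 - c 1) * (a 1 - e 1) with hga
  set gb := (d 0 - c 0) * (b 0 - e 0) + (d 1 - c 1) * (b 1 - e 1) with hgb
  -- In the orthogonal frame along `d - c` with origin `e`, the point `a` has coordinates
  -- proportional to `ga` and `signedArea c d a`, and similarly for `b`. The thresholds are thus
  -- negated cotangents of the angles at `e`.
  have hid : ((d 0 - c 0) ^ 2 + (d 1 - c 1) ^ 2) * signedArea a b e =
      ga * signedArea c d b - signedArea c d a * gb := by
    have e1 : signedArea c d a = signedArea c d a - signedArea c d e := by rw [he, sub_zero]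
    have e2 : signedArea c d b = signedArea c d b - signedArea c d e := by rw [he, sub_zero]
    rw [e1, e2, hga, hgb]
    simp only [signedArea]
    ring
  have hu : 0 < (d 0 - c 0) ^ 2 + (d 1 - c 1) ^ 2 := by
    by_contra hn
    have h0 : d 0 - c 0 = 0 := by nlinarith [sq_nonneg (d 0 - c 0), sq_nonneg (d 1 - c 1)]
    have h1 : d 1 - c 1 = 0 := by nlinarith [sq_nonneg (d 0 - c 0), sq_nonneg (d 1 - c 1)]
    simp [signedArea, h0, h1] at ha
  generalize signedArea c d a = x at *
  generalize signedArea c d b = y at *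
  rw [← neg_div_neg_eq (-gb) y, div_lt_div_iff₀ ha (neg_pos.2 hb)]
  constructor
  · intro h
    have := mul_neg_of_pos_of_neg hu h
    nlinarith
  · intro h
    by_contra h2
    have := mul_nonneg hu.le (not_lt.1 h2)
    nlinarith

section QuasiRandom

variable {V : Type*} [Fintype V]

open Classical in
/-- For a fixed edge `c d`, a weight that is small on rectangles is small on the pairs `a b` that
cross `c d`. -/
theorem GeneralPosition.abs_sum_crosses_le {f : V → Plane} (hf : GeneralPosition f)
    {w : V → V → ℝ} (hw : ∀ a b, |w a b| ≤ 1) (hsymm : ∀ a b, w a b = w b a) {E : ℝ}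
    (hE : ∀ X Y : Finset V, |∑ a ∈ X, ∑ b ∈ Y, w a b| ≤ E)
    {m k : ℕ} (hmk : Fintype.card V ≤ k * m) (c d : V) :
    |∑ a, ∑ b, if Crosses (f a) (f b) (f c) (f d) then w a b else 0| ≤
      4 * (k * E + m * Fintype.card V) := by
  set L : Finset V := {a | 0 < signedArea (f c) (f d) (f a)} with hL
  set R : Finset V := {a | signedArea (f c) (f d) (f a) < 0} with hR
  set t : V → V → ℝ := fun a b => if Crosses (f a) (f b) (f c) (f d) then w a b else 0 with ht
  have tsymm : ∀ a b, t a b = t b a := fun a b => by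
    simp only [ht, hsymm a b, Crosses.comm_left (a := f a)]
  have tsplit : ∀ a b, t a b = (if a ∈ L then if b ∈ R then t a b else 0 else 0) +
      (if b ∈ L then if a ∈ R then t b a else 0 else 0) := by
    intro a b
    rw [tsymm b a]
    simp only [hL, hR, Finset.mem_filter, Finset.mem_univ, true_and]
    by_cases hc : Crosses (f a) (f b) (f c) (f d)
    · rcases mul_neg_iff.1 hc.2 with ⟨h1, h2⟩ | ⟨h1, h2⟩
      · simp [h1, h2, h2.not_gt]
      · simp [h1, h2, h1.not_gt]
    · simp [ht, hc]
  have hsum : ∑ a, ∑ b, t a b = 2 * ∑ a ∈ L, ∑ b ∈ R, t a b := by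
    have h1 : ∑ a, ∑ b, (if a ∈ L then if b ∈ R then t a b else 0 else 0) =
        ∑ a ∈ L, ∑ b ∈ R, t a b := by
      have : ∀ a, ∑ b, (if a ∈ L then if b ∈ R then t a b else 0 else 0) =
          if a ∈ L then ∑ b ∈ R, t a b else 0 := fun a => by
        split_ifs
        · rw [Finset.sum_ite_mem, Finset.univ_inter]
        · exact Finset.sum_const_zero
      rw [Finset.sum_congr rfl fun a _ => this a, Finset.sum_ite_mem, Finset.univ_inter]
    have h2 : ∑ a, ∑ b, (if b ∈ L then if a ∈ R then t b a else 0 else 0) =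
        ∑ a ∈ L, ∑ b ∈ R, t a b := by
      rw [Finset.sum_comm, h1]
    calc ∑ a, ∑ b, t a b = ∑ a, ∑ b, ((if a ∈ L then if b ∈ R then t a b else 0 else 0) +
          (if b ∈ L then if a ∈ R then t b a else 0 else 0)) :=
          Finset.sum_congr rfl fun a _ => Finset.sum_congr rfl fun b _ => tsplit a b
      _ = 2 * ∑ a ∈ L, ∑ b ∈ R, t a b := by
          simp only [Finset.sum_add_distrib, h1, h2]
          ring
  let φ : V → V → ℝ := fun e a =>
    -((f d 0 - f c 0) * (f a 0 - f e 0) + (f d 1 - f c 1) * (f a 1 - f e 1)) /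
      signedArea (f c) (f d) (f a)
  -- For `a ∈ L`, `b ∈ R`, `signedArea_four` gives `signedArea a b c < signedArea a b d`. Hence
  -- negativity at `d` implies negativity at `c`, and crossing is the difference of these two nested
  -- threshold relations.
  have hdiff : ∑ a ∈ L, ∑ b ∈ R, t a b =
      ∑ a ∈ L, ∑ b ∈ R, (if φ c a < φ c b then w a b else 0) -
      ∑ a ∈ L, ∑ b ∈ R, (if φ d a < φ d b then w a b else 0) := by
    simp only [← Finset.sum_sub_distrib]
    refine Finset.sum_congr rfl fun a ha => Finset.sum_congr rfl fun b hb => ?_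
    have ha : 0 < signedArea (f c) (f d) (f a) := by simpa [hL] using ha
    have hb : signedArea (f c) (f d) (f b) < 0 := by simpa [hR] using hb
    have hc := signedArea_neg_iff (signedArea_self_outer (f c) (f d)) ha hb
    have hd := signedArea_neg_iff (signedArea_self_right (f c) (f d)) ha hb
    have h4 := signedArea_four (f a) (f b) (f c) (f d)
    have hne : signedArea (f a) (f b) (f d) ≠ 0 := by
      refine hf a b d ?_ ?_ ?_
      · rintro rfl; linarith
      · rintro rfl; rw [signedArea_self_right] at ha; exact ha.false
      · rintro rfl; rw [signedArea_self_right] at hb; exact hb.false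
    have hcr : Crosses (f a) (f b) (f c) (f d) ↔
        signedArea (f a) (f b) (f c) < 0 ∧ ¬ signedArea (f a) (f b) (f d) < 0 := by
      constructor
      · intro h
        rcases mul_neg_iff.1 h.1 with ⟨h1, h2⟩ | ⟨h1, h2⟩
        · linarith
        · exact ⟨h1, h2.not_gt⟩
      · rintro ⟨h1, h2⟩
        exact ⟨mul_neg_of_neg_of_pos h1 (lt_of_le_of_ne (not_lt.1 h2) hne.symm),
          mul_neg_of_pos_of_neg ha hb⟩
    simp only [ht, φ, ← hc, ← hd, hcr]
    by_cases h1 : signedArea (f a) (f b) (f c) < 0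
    · by_cases h2 : signedArea (f a) (f b) (f d) < 0 <;> simp [h1, h2]
    · have h2 : ¬ signedArea (f a) (f b) (f d) < 0 := by linarith
      simp [h1, h2]
  have bound : ∀ e, |∑ a ∈ L, ∑ b ∈ R, if φ e a < φ e b then w a b else 0| ≤
      k * E + m * Fintype.card V := fun e =>
    (abs_sum_threshold_le hw hE (φ e) (φ e) m k L R ((Finset.card_le_univ L).trans hmk)).trans
      (by gcongr; exact Finset.card_le_univ R)
  rw [hsum, hdiff, abs_mul, abs_two]
  have := (abs_sub (∑ a ∈ L, ∑ b ∈ R, (if φ c a < φ c b then w a b else 0))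
      (∑ a ∈ L, ∑ b ∈ R, (if φ d a < φ d b then w a b else 0))).trans
    (add_le_add (bound c) (bound d))
  linarith

open Classical in
theorem cast_card_crossingQuadruples (G : SimpleGraph V) (f : V → Plane) :
    ((crossingQuadruples G f).card : ℝ) = ∑ a, ∑ b, ∑ c, ∑ d,
      if Crosses (f a) (f b) (f c) (f d) then
        (if G.Adj a b then 1 else 0) * (if G.Adj c d then 1 else 0) else 0 := by
  rw [crossingQuadruples, Finset.card_filter]
  push_cast
  simp only [Fintype.sum_prod_type]
  refine Finset.sum_congr rfl fun a _ => Finset.sum_congr rfl fun b _ =>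
    Finset.sum_congr rfl fun c _ => Finset.sum_congr rfl fun d _ => ?_
  split_ifs <;> simp_all

open Classical in
theorem cast_card_crossingQuadruples_top (f : V → Plane) :
    ((crossingQuadruples ⊤ f).card : ℝ) = ∑ a, ∑ b, ∑ c, ∑ d,
      if Crosses (f a) (f b) (f c) (f d) then 1 else 0 := by
  rw [cast_card_crossingQuadruples]
  refine Finset.sum_congr rfl fun a _ => Finset.sum_congr rfl fun b _ =>
    Finset.sum_congr rfl fun c _ => Finset.sum_congr rfl fun d _ => ?_
  split_ifs with h h1 h2 h2
  · simp
  · exact absurd (fun e => h.ne_snd (congrArg f e)) h2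
  all_goals first | exact absurd (fun e => h.ne_fst (congrArg f e)) h1 | rfl

/-- In every placement in general position, a graph with small discrepancy has about the
expected number of crossings. -/
theorem GeneralPosition.abs_card_sub_le {f : V → Plane} (hf : GeneralPosition f)
    (G : SimpleGraph V) {p : ℝ} (hp₀ : 0 ≤ p) (hp₁ : p ≤ 1) {E : ℝ}
    (hE : ∀ X Y : Finset V, |(edgeCount G X Y : ℝ) - p * (X.card : ℝ) * (Y.card : ℝ)| ≤ E)
    {m k : ℕ} (hmk : Fintype.card V ≤ k * m) :
    |((crossingQuadruples G f).card : ℝ) - p ^ 2 * (crossingQuadruples ⊤ f).card| ≤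
      8 * (Fintype.card V : ℝ) ^ 2 * (k * E + m * Fintype.card V) := by
  classical
  set g : V → V → ℝ := fun a b => if G.Adj a b then 1 else 0 with hg
  set w : V → V → ℝ := fun a b => g a b - p with hw
  have hg0 : ∀ a b, |g a b| ≤ 1 := fun a b => by simp only [hg]; split_ifs <;> simp
  have hw1 : ∀ a b, |w a b| ≤ 1 := fun a b => by
    simp only [hw, hg, abs_le]; split_ifs <;> constructor <;> linarith
  have hws : ∀ a b, w a b = w b a := fun a b => by simp only [hw, hg, G.adj_comm]
  have hwE : ∀ X Y : Finset V, |∑ a ∈ X, ∑ b ∈ Y, w a b| ≤ E := by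
    intro X Y
    convert hE X Y using 2
    have : (edgeCount G X Y : ℝ) = ∑ a ∈ X, ∑ b ∈ Y, g a b := by
      rw [edgeCount, SimpleGraph.interedges, Rel.interedges, Finset.card_filter]
      push_cast
      rw [Finset.sum_product]
    rw [this]
    simp only [hw, Finset.sum_sub_distrib, Finset.sum_const, nsmul_eq_mul]
    ring
  set T : ℝ := 4 * (k * E + m * Fintype.card V) with hT
  set s : V → V → ℝ := fun c d => ∑ a, ∑ b, if Crosses (f a) (f b) (f c) (f d) then w a b else 0
    with hs
  have hsT : ∀ c d, |s c d| ≤ T := fun c d => hf.abs_sum_crosses_le hw1 hws hwE hmk c d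
  have hT0 : 0 ≤ T := by
    have := (abs_nonneg _).trans (hE ∅ ∅)
    positivity
  have hsum : ∀ u : V → V → ℝ, (∀ a b, |u a b| ≤ 1) →
      |∑ c, ∑ d, u c d * s c d| ≤ (Fintype.card V : ℝ) ^ 2 * T := by
    intro u hu
    calc |∑ c, ∑ d, u c d * s c d| ≤ ∑ c, ∑ d, |u c d * s c d| :=
          (Finset.abs_sum_le_sum_abs _ _).trans
            (Finset.sum_le_sum fun a _ => Finset.abs_sum_le_sum_abs _ _)
      _ ≤ ∑ c : V, ∑ d : V, T := by
          refine Finset.sum_le_sum fun c _ => Finset.sum_le_sum fun d _ => ?_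
          rw [abs_mul]
          exact (mul_le_mul (hu c d) (hsT c d) (abs_nonneg _) zero_le_one).trans_eq (one_mul _)
      _ = (Fintype.card V : ℝ) ^ 2 * T := by
          simp only [Finset.sum_const, Finset.card_univ, nsmul_eq_mul]; ring
  -- Summand by summand, `g a b * g c d - p ^ 2 = g a b * w c d + p * w a b`.
  have key : ((crossingQuadruples G f).card : ℝ) - p ^ 2 * (crossingQuadruples ⊤ f).card =
      ∑ c, ∑ d, g c d * s c d + ∑ a, ∑ b, p * s a b := by
    have h1 : ∑ c, ∑ d, g c d * s c d = ∑ a, ∑ b, ∑ c, ∑ d,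
        g a b * if Crosses (f a) (f b) (f c) (f d) then w c d else 0 := by
      refine Finset.sum_congr rfl fun a _ => Finset.sum_congr rfl fun b _ => ?_
      simp only [hs, Finset.mul_sum, Crosses.comm (c := f a)]
    have h2 : ∑ c, ∑ d, p * s c d = ∑ a, ∑ b, ∑ c, ∑ d,
        p * if Crosses (f a) (f b) (f c) (f d) then w a b else 0 := by
      have hcomm : ∀ F : V → V → V → V → ℝ,
          ∑ c, ∑ d, ∑ a, ∑ b, F a b c d = ∑ a, ∑ b, ∑ c, ∑ d, F a b c d := by
        intro F
        have := Finset.sum_comm (s := (Finset.univ : Finset (V × V)))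
          (t := (Finset.univ : Finset (V × V))) (f := fun x y => F y.1 y.2 x.1 x.2)
        simpa only [Fintype.sum_prod_type] using this
      simp only [hs, Finset.mul_sum]
      exact hcomm _
    rw [h1, h2, cast_card_crossingQuadruples, cast_card_crossingQuadruples_top]
    simp only [Finset.mul_sum, ← Finset.sum_sub_distrib, ← Finset.sum_add_distrib]
    refine Finset.sum_congr rfl fun a _ => Finset.sum_congr rfl fun b _ =>
      Finset.sum_congr rfl fun c _ => Finset.sum_congr rfl fun d _ => ?_
    by_cases hc : Crosses (f a) (f b) (f c) (f d)
    · simp only [hc, if_true, hw, hg]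
      ring
    · simp [hc]
  rw [key]
  have b1 := hsum g hg0
  have b2 := hsum (fun _ _ => p) (fun _ _ => by rw [abs_of_nonneg hp₀]; exact hp₁)
  have b3 := (abs_add_le _ _).trans (add_le_add b1 b2)
  refine b3.trans (le_of_eq ?_)
  rw [hT]
  ring

end QuasiRandom

/-! ### Comparison of the crossing numbers. -/

/-- The rectilinear crossing number of `K_n` has order of magnitude `n ^ 4`. -/
theorem pow_four_le_rectilinearCrossingNumber_top {V : Type*} [Fintype V]
    (hV : 8 ≤ Fintype.card V) :
    (Fintype.card V : ℝ) ^ 4 ≤ 800000 * rectilinearCrossingNumber (⊤ : SimpleGraph V) := by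
  obtain ⟨f, hf, hcard⟩ := exists_drawing_card_eq (⊤ : SimpleGraph V)
  have h1 := hf.generalPosition.descFactorial_le
  have h2 := Nat.pow_sub_le_descFactorial (Fintype.card V) 5
  rw [hcard] at h1
  generalize Fintype.card V = n at *
  generalize rectilinearCrossingNumber (⊤ : SimpleGraph V) = K at *
  -- This uses `n ≥ 8`; the final constant is `800000 = 2 ^ 5 * 5 ^ 5 * 8`.
  have h3 : n ≤ 2 * (n + 1 - 5) := by omega
  have h4 : n ^ 5 ≤ 32 * (n + 1 - 5) ^ 5 := by
    calc n ^ 5 ≤ (2 * (n + 1 - 5)) ^ 5 := Nat.pow_le_pow_left h3 5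
      _ = 32 * (n + 1 - 5) ^ 5 := by rw [mul_pow]; norm_num
  have h5 : n * n ^ 4 ≤ n * (800000 * K) := by
    calc n * n ^ 4 = n ^ 5 := by ring
      _ ≤ 32 * (5 ^ 5 * (K * 8 * n)) := h4.trans (Nat.mul_le_mul_left _ (h2.trans h1))
      _ = n * (800000 * K) := by ring
  exact_mod_cast Nat.le_of_mul_le_mul_left h5 (by omega)

/-- The crossing number of a graph with small discrepancy compared with that of the complete
graph. -/
theorem abs_rectilinearCrossingNumber_sub_le {V : Type*} [Fintype V] (G : SimpleGraph V) {p : ℝ}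
    (hp₀ : 0 ≤ p) (hp₁ : p ≤ 1) {E : ℝ}
    (hE : ∀ X Y : Finset V, |(edgeCount G X Y : ℝ) - p * (X.card : ℝ) * (Y.card : ℝ)| ≤ E)
    {m k : ℕ} (hmk : Fintype.card V ≤ k * m) :
    |(rectilinearCrossingNumber G : ℝ) -
        p ^ 2 * rectilinearCrossingNumber (⊤ : SimpleGraph V)| ≤
      (Fintype.card V : ℝ) ^ 2 * (k * E + m * Fintype.card V) := by
  obtain ⟨f, hf, hfcard⟩ := exists_drawing_card_eq G
  obtain ⟨h, hh, hhcard⟩ := exists_drawing_card_eq (⊤ : SimpleGraph V)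
  have b1 := hf.generalPosition.abs_card_sub_le G hp₀ hp₁ hE hmk
  have b2 := hh.generalPosition.abs_card_sub_le G hp₀ hp₁ hE hmk
  have hhG : IsStraightLineDrawing G h :=
    ⟨hh.injective, hh.not_collinear, fun e₁ h₁ e₂ h₂ e₃ h₃ =>
      hh.no_triple_point e₁ (SimpleGraph.edgeSet_mono le_top h₁)
        e₂ (SimpleGraph.edgeSet_mono le_top h₂) e₃ (SimpleGraph.edgeSet_mono le_top h₃)⟩
  -- An optimal drawing of `G` may have triple points among non-edges, so it need not be a drawing
  -- of the complete graph; the bound used here perturbs it.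
  have c1 : (rectilinearCrossingNumber (⊤ : SimpleGraph V) : ℝ) * 8 ≤
      (crossingQuadruples ⊤ f).card := by
    exact_mod_cast hf.generalPosition.rectilinearCrossingNumber_top_le
  have c2 : (rectilinearCrossingNumber G : ℝ) * 8 ≤ (crossingQuadruples G h).card := by
    exact_mod_cast rectilinearCrossingNumber_le hhG
  rw [hfcard] at b1
  rw [hhcard] at b2
  push_cast at b1 b2
  rw [abs_le] at b1 b2 ⊢
  have c3 := mul_le_mul_of_nonneg_left c1 (sq_nonneg p)
  constructor <;> linarith

theorem theorem2 (p : ℝ) (hp₀ : 0 < p) (hp₁ : p < 1)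
    {V : ℕ → Type*} [∀ n, Fintype (V n)] (hV : ∀ n, 1 ≤ n → Fintype.card (V n) = n)
    (G : ∀ n, SimpleGraph (V n)) (hG : IsQuasiRandom G p) :
    Asymptotics.IsEquivalent Filter.atTop
      (fun n : ℕ => (rectilinearCrossingNumber (G n) : ℝ))
      (fun n : ℕ => p ^ 2 * (rectilinearCrossingNumber (⊤ : SimpleGraph (Fin n)) : ℝ)) := by
  rw [Asymptotics.IsEquivalent, Asymptotics.isLittleO_iff]
  intro c hc
  -- Chosen so that an error `δ * n ^ 4` is at most `c * p ^ 2 * K`. With `m = n / k + 1`, the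
  -- discrepancy, `n / k` and the rounding `1` each contribute at most a third of it; `k` is fixed
  -- before the discrepancy bound `δ / (3 * k)` is requested.
  set δ : ℝ := c * p ^ 2 / 800000 with hδ
  have hδ0 : 0 < δ := by positivity
  obtain ⟨k, hk⟩ := exists_nat_ge (3 / δ)
  have hk0 : (0 : ℝ) < k := (by positivity : 0 < 3 / δ).trans_le hk
  have hk0' : 0 < k := by exact_mod_cast hk0
  obtain ⟨N, hN⟩ := hG (δ / (3 * k)) (by positivity)
  filter_upwards [Filter.eventually_ge_atTop N, Filter.eventually_ge_atTop 8,
    Filter.eventually_ge_atTop ⌈3 / δ⌉₊] with n hnN hn8 hnδ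
  have hcard := hV n (by omega)
  have hn0 : (0 : ℝ) < n := by exact_mod_cast (by omega : 0 < n)
  have hnδ' : 3 / δ ≤ n := Nat.ceil_le.1 hnδ
  have hmk : Fintype.card (V n) ≤ k * (n / k + 1) := by
    rw [hcard]
    exact (Nat.lt_mul_div_succ n hk0').le
  have h1 := abs_rectilinearCrossingNumber_sub_le (G n) hp₀.le hp₁.le (hN n hnN) hmk
  have h2 := pow_four_le_rectilinearCrossingNumber_top (V := Fin n) (by simpa using hn8)
  rw [rectilinearCrossingNumber_top_congr (V := Fin n) (Fintype.equivFinOfCardEq hcard),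
    hcard] at h1
  rw [Fintype.card_fin] at h2
  simp only [Pi.sub_apply, Real.norm_eq_abs]
  generalize rectilinearCrossingNumber (⊤ : SimpleGraph (Fin n)) = K at *
  have hm : ((n / k + 1 : ℕ) : ℝ) * n ≤ 2 * δ / 3 * (n : ℝ) ^ 2 := by
    have e1 : ((n / k : ℕ) : ℝ) ≤ δ / 3 * n := by
      refine Nat.cast_div_le.trans ?_
      rw [div_le_iff₀ hk0]
      have : 1 ≤ δ / 3 * k := by
        rw [div_le_iff₀ hδ0] at hk
        linarith
      nlinarith
    have e2 : 1 ≤ δ / 3 * n := by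
      rw [div_le_iff₀ hδ0] at hnδ'
      linarith
    push_cast
    nlinarith
  have hE : (k : ℝ) * (δ / (3 * k) * (n : ℝ) ^ 2) = δ / 3 * (n : ℝ) ^ 2 := by
    field_simp
  calc |(rectilinearCrossingNumber (G n) : ℝ) - p ^ 2 * K|
      ≤ (n : ℝ) ^ 2 * (k * (δ / (3 * k) * (n : ℝ) ^ 2) + ((n / k + 1 : ℕ) : ℝ) * n) := h1
    _ ≤ (n : ℝ) ^ 2 * (δ / 3 * (n : ℝ) ^ 2 + 2 * δ / 3 * (n : ℝ) ^ 2) := by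
        rw [hE]
        gcongr
    _ = δ * (n : ℝ) ^ 4 := by ring
    _ ≤ δ * (800000 * K) := by gcongr
    _ = c * (p ^ 2 * K) := by rw [hδ]; ring
    _ = c * |p ^ 2 * (K : ℝ)| := by rw [abs_of_nonneg (by positivity)]
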